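/- Let $(X_j)_{j\ge 1}$ be a strictly stationary sequence of real random variables on a probability space, with continuous marginal distribution function $F(x)=\mathbb P(X_1\le x)$, and let $M_n=\max_{1\le j\le n}X_j$. A distribution function $G$ on $\mathbb R$ is called a phantom distribution function for $(X_j)$ if $\sup_{u\in\mathbb R}\left|\mathbb P(M_n\le u)-G(u)^n\right|\to 0$ as $n\to\infty$. For $s\in\mathbb N$, let $\mathcal M^s$ be the set of all non-constant measurable functions $f:\mathbb R^s\to\mathbb R$ with $\sup|f|\le 1$, and put $$\mathrm{Lip}\,f=\sup_{x\neq y}\frac{|f(y)-f(x)|}{|y_1-x_1|+\cdots+|y_s-x_s|}\in(0,\infty].$$ For $r\in\mathbb N$ define $\kappa(r)\in[0,\infty]$ by $$\kappa(r)=\sup\frac{\left|\mathrm{Cov}\big(f(X_{i_1},\dots,X_{i_s}),\,g(X_{j_1},\dots,X_{j_t})\big)\right|}{\Psi(f,g)},\qquad \Psi(f,g)=s\,t\,\mathrm{Lip}\,f\;\mathrm{Lip}\,g,$$ where the supremum is over all $s,t\ge 1$, $f\in\mathcal M^s$, $g\in\mathcal M^t$ and all indices $i_1\le\cdots\le i_s\le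 j_1\le\cdots\le j_t$ with $j_1-i_s\ge r$ (the quotient is $0$ if $\Psi(f,g)=\infty$). Define $\lambda(r)$ in the same way, with $\Psi(f,g)=s\,\mathrm{Lip}\,f+t\,\mathrm{Lip}\,g+s\,t\,\mathrm{Lip}\,f\;\mathrm{Lip}\,g$. The sequence is called $\kappa$-weakly (respectively $\lambda$-weakly) dependent if $\kappa(r)\to 0$ (respectively $\lambda(r)\to 0$) as $r\to\infty$. Suppose that the concentration assumption holds: there are constants $b>0$ and $B>0$ such that $F(x+u)-F(x)\le B\,u^b$ for all $x\in\mathbb R$ and $u>0$. Let $\beta>(1+\sqrt5)\left(1+\frac2b\right)$. (a) If $(X_j)$ is $\kappa$-weakly dependent and $\kappa(r)=O(r^{-\beta})$ as $r\to\infty$, then $(X_j)$ admits a continuous phantom distribution function. (b) If $(X_j)$ is $\lambda$-weakly dependent and $\lambda(r)=O(r^{-\beta})$ as $r\to\infty$, then $(X_j)$ admits a continuous phantom distribution function. -/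

import Mathlib

open MeasureTheory ProbabilityTheory Filter Topology
open scoped ENNReal

noncomputable section

namespace PhantomDF

/-- Strict stationarity of the sequence `X 0, X 1, X 2, …` under `P`: every time shift leaves the
law of the whole sequence (on `ℕ → ℝ` with the product σ-algebra) unchanged. -/
def StrictlyStationary {Ω : Type*} [MeasurableSpace Ω] (P : Measure Ω) (X : ℕ → Ω → ℝ) : Prop :=
  ∀ k : ℕ, P.map (fun ω (j : ℕ) => X (j + k) ω) = P.map (fun ω (j : ℕ) => X j ω)

/-- The partial maximum `M_n`, the largest of the first `n` terms `X 0, …, X (n - 1)`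
(only used for large `n`; the value for `n = 0` is irrelevant). -/
def partialMax {Ω : Type*} (X : ℕ → Ω → ℝ) (n : ℕ) (ω : Ω) : ℝ :=
  ⨆ j : Fin n, X j ω

/-- `G` is a (probability) distribution function on the real line. -/
structure IsDistributionFunction (G : ℝ → ℝ) : Prop where
  mono : Monotone G
  right_continuous : ∀ x, ContinuousWithinAt G (Set.Ici x) x
  tendsto_atBot : Tendsto G atBot (𝓝 0)
  tendsto_atTop : Tendsto G atTop (𝓝 1)

/-- `G` is a phantom distribution function for `X`:
`sup_u |P(M_n ≤ u) - G(u)^n| → 0`. -/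
def IsPhantom {Ω : Type*} [MeasurableSpace Ω] (P : Measure Ω) (X : ℕ → Ω → ℝ)
    (G : ℝ → ℝ) : Prop :=
  IsDistributionFunction G ∧
    Tendsto (fun n : ℕ => ⨆ u : ℝ, |P.real {ω | partialMax X n ω ≤ u} - G u ^ n|) atTop (𝓝 0)

/-- The sequence admits a continuous phantom distribution function. -/
def AdmitsContinuousPhantom {Ω : Type*} [MeasurableSpace Ω] (P : Measure Ω)
    (X : ℕ → Ω → ℝ) : Prop :=
  ∃ G : ℝ → ℝ, Continuous G ∧ IsPhantom P X G

/-- Concentration assumption with exponent `b` for a distribution function `F`. -/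
def Concentration (F : ℝ → ℝ) (b : ℝ) : Prop :=
  ∃ B : ℝ, 0 < B ∧ ∀ x u : ℝ, 0 < u → F (x + u) - F x ≤ B * u ^ b

/-- The class of measurable non-constant functions on `ℝ^s` bounded by one in absolute value.
It is empty for `s = 0`. -/
structure IsTestFunction {s : ℕ} (f : (Fin s → ℝ) → ℝ) : Prop where
  measurable : Measurable f
  abs_le_one : ∀ x, |f x| ≤ 1
  nonconstant : ∃ x y, f x ≠ f y

/-- The Lipschitz coefficient with respect to the `ℓ¹` distance, with values in `[0, ∞]`. -/
def lip {s : ℕ} (f : (Fin s → ℝ) → ℝ) : ℝ≥0∞ :=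
  ⨆ (x : Fin s → ℝ) (y : Fin s → ℝ) (_ : y ≠ x),
    ENNReal.ofReal |f y - f x| / ENNReal.ofReal (∑ i, |y i - x i|)

/-- A weight `Ψ(f, g)` on pairs of functions of `s` and of `t` real variables. -/
abbrev Weight : Type :=
  (s t : ℕ) → ((Fin s → ℝ) → ℝ) → ((Fin t → ℝ) → ℝ) → ℝ≥0∞

/-- The weight of `κ`-dependence, `s t Lip f Lip g`. -/
def kappaWeight : Weight := fun s t f g => (s : ℝ≥0∞) * t * lip f * lip g

/-- The weight of `λ`-dependence, `s Lip f + t Lip g + s t Lip f Lip g`. -/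
def lambdaWeight : Weight := fun s t f g =>
  (s : ℝ≥0∞) * lip f + t * lip g + s * t * lip f * lip g

/-- The dependence coefficient at gap `r` for the weight `Ψ`: the supremum of
`|cov (f(X_{i_1}, …, X_{i_s}), g(X_{j_1}, …, X_{j_t}))| / Ψ(f, g)` over test functions `f`, `g` and
indices `i_1 ≤ ⋯ ≤ i_s ≤ j_1 ≤ ⋯ ≤ j_t` with `j_1 - i_s ≥ r`. The quotient is zero where the
weight is infinite; for the weights above it is never zero on test functions. -/
def dependenceCoeff {Ω : Type*} [MeasurableSpace Ω] (Ψ : Weight) (P : Measure Ω)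
    (X : ℕ → Ω → ℝ) (r : ℕ) : ℝ≥0∞ :=
  ⨆ (s : ℕ) (t : ℕ) (f : (Fin s → ℝ) → ℝ) (g : (Fin t → ℝ) → ℝ)
    (_ : IsTestFunction f) (_ : IsTestFunction g)
    (i : Fin s → ℕ) (j : Fin t → ℕ) (_ : Monotone i) (_ : Monotone j)
    (_ : ∀ a b, i a + r ≤ j b),
    ENNReal.ofReal |cov[fun ω => f (fun a => X (i a) ω), fun ω => g (fun a => X (j a) ω); P]|
      / Ψ s t f g

/-- Weak dependence for the weight `Ψ`: the coefficients tend to zero. -/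
def WeaklyDependent {Ω : Type*} [MeasurableSpace Ω] (Ψ : Weight) (P : Measure Ω)
    (X : ℕ → Ω → ℝ) : Prop :=
  Tendsto (dependenceCoeff Ψ P X) atTop (𝓝 0)

/-- `ε(r) = O(r^{-β})` as `r → ∞`, for a `[0, ∞]`-valued sequence `ε`. -/
def HasPolynomialRate (ε : ℕ → ℝ≥0∞) (β : ℝ) : Prop :=
  ∃ C : ℝ, ∀ᶠ r : ℕ in atTop, ε r ≤ ENNReal.ofReal (C * (r : ℝ) ^ (-β))

end PhantomDF

end

/-! Write `a m n` for the probability that `M_n ≤ v m`, where the level `v m` is chosen so that `a m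
m` is close to `1/2`. If maxima over adjacent blocks of total length `O(m)` are asymptotically
independent at level `v m`, then `a m (p + q) ≈ a m p * a m q`. This approximate Cauchy equation and
monotonicity in `n` force `a m n ≈ (1/2) ^ (n / m)`, uniformly in all `n`. A continuous `G` equal to
`(1/2) ^ (1 / m)` at `v m` then has `G ^ n` close to the law of `M_n` at every level far along the
sequence. Consecutive values of `G ^ n` there differ by at most about `1 / m`, so monotonicity fills
in the levels between.

Independence comes from weak dependence in two moves. For two blocks separated by a gap `r`,
indicators are replaced by products of `δ⁻¹`-Lipschitz ramps: concentration bounds the smoothing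
error by a multiple of `m * δ ^ b`, and the dependence coefficient bounds the covariance by a
multiple of `r ^ (-β) * (m / δ + (m / δ) ^ 2)`. Filling the gap is then free, because about `m / (2
r)` separated blocks of length `r` fit into `m` indices: were the chance of an exceedance in one of
them not negligible, `a m m` would fall below any positive constant.

The choices `r ≈ m ^ (2/3)` and `δ = m ^ (-3 / (2 b))` make all errors vanish once `β ≥ 3 (1 + 2 /
b)`, which the assumption implies since `3 ≤ 1 + √5`. The `κ`-weight is dominated by the `λ`-weight,
so one argument covers both cases. -/

namespace PhantomDF

/-! ### Interpolation by continuous distribution functions -/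

/-- A continuous distribution function with prescribed values along a strictly increasing
sequence. -/
theorem exists_continuous_isDistributionFunction_interpolating {v g : ℕ → ℝ} (hv : StrictMono v)
    (hg : Monotone g) (hg0 : 0 ≤ g 0) (hg1 : Tendsto g atTop (𝓝 1)) :
    ∃ G : ℝ → ℝ, Continuous G ∧ IsDistributionFunction G ∧ ∀ m, G (v m) = g m := by
  -- Each `ψ m` climbs from 0 at `v m` to 1 at `v (m + 1)`, so weighting by the increments of `g`
  -- makes the series telescope at the nodes.
  set ψ : ℕ → ℝ → ℝ := fun m u => max 0 (min 1 ((u - v m) / (v (m + 1) - v m))) with hψ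
  set w : ℕ → ℝ := fun m => g (m + 1) - g m with hw
  have hd : ∀ m, 0 < v (m + 1) - v m := fun m => sub_pos.2 (hv m.lt_succ_self)
  have hw0 : ∀ m, 0 ≤ w m := fun m => sub_nonneg.2 (hg m.le_succ)
  have hψ0 : ∀ m u, 0 ≤ ψ m u := fun m u => le_max_left _ _
  have hψ1 : ∀ m u, ψ m u ≤ 1 := fun m u => max_le zero_le_one (min_le_left _ _)
  have hψmono : ∀ m, Monotone (ψ m) := fun m x y hxy => by
    have := hd m
    simp only [hψ]
    gcongr
  have hψc : ∀ m, Continuous (ψ m) := fun m => by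
    simp only [hψ]
    fun_prop
  have hψzero : ∀ m u, u ≤ v m → ψ m u = 0 := fun m u hu => by
    have : (u - v m) / (v (m + 1) - v m) ≤ 0 :=
      div_nonpos_of_nonpos_of_nonneg (sub_nonpos.2 hu) (hd m).le
    exact max_eq_left ((min_le_right _ _).trans this)
  have hψone : ∀ m u, v (m + 1) ≤ u → ψ m u = 1 := fun m u hu => by
    have : 1 ≤ (u - v m) / (v (m + 1) - v m) := by
      rw [one_le_div (hd m)]; linarith
    simp only [hψ]
    rw [min_eq_left this, max_eq_right zero_le_one]
  have hws : HasSum w (1 - g 0) := by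
    rw [hasSum_iff_tendsto_nat_of_nonneg hw0]
    simp only [hw, Finset.sum_range_sub]
    exact hg1.sub_const _
  have hbound : ∀ m u, ‖w m * ψ m u‖ ≤ w m := fun m u => by
    rw [Real.norm_of_nonneg (mul_nonneg (hw0 m) (hψ0 m u))]
    exact mul_le_of_le_one_right (hw0 m) (hψ1 m u)
  have hsum : ∀ u, Summable fun m => w m * ψ m u := fun u =>
    Summable.of_norm_bounded hws.summable fun m => hbound m u
  -- The exponential factor is 1 from `v 0` onwards; it only brings `G` down to 0 at `-∞`. The
  -- sequence `v` may be bounded, in which case `G = 1` beyond its supremum.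
  set G : ℝ → ℝ := fun u => g 0 * min 1 (Real.exp (u - v 0)) + ∑' m, w m * ψ m u with hG
  have hGc : Continuous G :=
    (by fun_prop : Continuous fun u => g 0 * min 1 (Real.exp (u - v 0))).add
      (continuous_tsum (fun m => (hψc m).const_mul (w m)) hws.summable hbound)
  refine ⟨G, hGc, ⟨fun x y hxy => ?_, fun x => hGc.continuousWithinAt, ?_, ?_⟩, fun m => ?_⟩
  · refine add_le_add (by gcongr) ((hsum x).tsum_le_tsum (fun m => ?_) (hsum y))
    exact mul_le_mul_of_nonneg_left (hψmono m hxy) (hw0 m)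
  · have h1 : Tendsto (fun u => g 0 * min 1 (Real.exp (u - v 0))) atBot (𝓝 (g 0 * min 1 0)) :=
      (tendsto_const_nhds.min (Real.tendsto_exp_atBot.comp
        (tendsto_atBot_add_const_right _ (-v 0) tendsto_id))).const_mul _
    have h2 : Tendsto (fun u => ∑' m, w m * ψ m u) atBot (𝓝 (∑' _ : ℕ, (0 : ℝ))) := by
      refine tendsto_tsum_of_dominated_convergence hws.summable (fun m => ?_)
        (Eventually.of_forall fun u m => hbound m u)
      refine tendsto_const_nhds.congr' ?_
      filter_upwards [eventually_le_atBot (v m)] with u hu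
      rw [hψzero m u hu, mul_zero]
    simpa using h1.add h2
  · have h1 : Tendsto (fun u => g 0 * min 1 (Real.exp (u - v 0))) atTop (𝓝 (g 0)) := by
      refine tendsto_const_nhds.congr' ?_
      filter_upwards [eventually_ge_atTop (v 0)] with u hu
      rw [min_eq_left (Real.one_le_exp (sub_nonneg.2 hu)), mul_one]
    have h2 : Tendsto (fun u => ∑' m, w m * ψ m u) atTop (𝓝 (∑' m, w m)) := by
      refine tendsto_tsum_of_dominated_convergence hws.summable (fun m => ?_)
        (Eventually.of_forall fun u m => hbound m u)
      refine tendsto_const_nhds.congr' ?_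
      filter_upwards [eventually_ge_atTop (v (m + 1))] with u hu
      rw [hψone m u hu, mul_one]
    have := h1.add h2
    rwa [hws.tsum_eq, add_sub_cancel] at this
  · have h0 : v 0 ≤ v m := hv.monotone m.zero_le
    have h1 : ∑' k, w k * ψ k (v m) = ∑ k ∈ Finset.range m, w k := by
      rw [tsum_eq_sum (s := Finset.range m)]
      · refine Finset.sum_congr rfl fun k hk => ?_
        rw [hψone k _ (hv.monotone (Finset.mem_range.1 hk)), mul_one]
      · intro k hk
        rw [hψzero k _ (hv.monotone (by simpa using hk)), mul_zero]
    simp only [hG]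
    rw [h1, min_eq_left (Real.one_le_exp (sub_nonneg.2 h0)), Finset.sum_range_sub]
    ring

/-! ### Asymptotically multiplicative arrays -/

section Asymptotic

variable {a : ℕ → ℕ → ℝ}

/-- The difference `a m (p + q) - a m p * a m q` vanishes asymptotically for `p + q = O(m)`. -/
def AsympMultiplicative (a : ℕ → ℕ → ℝ) : Prop :=
  ∀ (T : ℕ) (p q : ℕ → ℕ), (∀ m, p m + q m ≤ T * m) →
    Tendsto (fun m => a m (p m + q m) - a m (p m) * a m (q m)) atTop (𝓝 0)

theorem AsympMultiplicative.tendsto_sub_pow (hmul : AsympMultiplicative a)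
    (h0 : ∀ m n, 0 ≤ a m n) (h1 : ∀ m n, a m n ≤ 1) (hz : ∀ m, a m 0 = 1)
    {T : ℕ} {q : ℕ → ℕ} (k : ℕ) (hq : ∀ m, k * q m ≤ T * m) :
    Tendsto (fun m => a m (k * q m) - a m (q m) ^ k) atTop (𝓝 0) := by
  induction k with
  | zero => simp [hz]
  | succ k ih =>
    have hk : ∀ m, k * q m + q m ≤ T * m := fun m => by
      have := hq m
      rwa [Nat.succ_mul] at this
    have e1 := hmul T (fun m => k * q m) q hk
    have e2 := ih fun m => (Nat.le_add_right _ _).trans (hk m)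
    have e3 : Tendsto (fun m => (a m (k * q m) - a m (q m) ^ k) * a m (q m)) atTop (𝓝 0) := by
      refine squeeze_zero_norm (fun m => ?_) (tendsto_zero_iff_norm_tendsto_zero.1 e2)
      rw [norm_mul, Real.norm_of_nonneg (h0 m (q m))]
      exact mul_le_of_le_one_right (norm_nonneg _) (h1 _ _)
    have := e1.add e3
    rw [add_zero] at this
    refine this.congr fun m => ?_
    rw [Nat.succ_mul, pow_succ]
    ring

/-- Split `j * m` into `k` blocks of length `j * m / k` and a remainder below `k`. The remainder
costs nothing by `hone`, so the `k`-th power of the block value tends to `γ ^ j`; take `k`-th roots.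
-/
theorem AsympMultiplicative.tendsto_mul_div (hmul : AsympMultiplicative a)
    (h0 : ∀ m n, 0 ≤ a m n) (h1 : ∀ m n, a m n ≤ 1) (hz : ∀ m, a m 0 = 1)
    (hanti : ∀ m, Antitone (a m)) (hone : ∀ c, Tendsto (fun m => a m c) atTop (𝓝 1))
    {γ : ℝ} (hγ : Tendsto (fun m => a m m) atTop (𝓝 γ)) (j : ℕ) {k : ℕ} (hk : 0 < k) :
    Tendsto (fun m => a m (j * m / k)) atTop (𝓝 (γ ^ ((j : ℝ) / k))) := by
  have hγ0 : 0 ≤ γ := ge_of_tendsto' hγ fun m => h0 m m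
  have e1 : Tendsto (fun m => a m (j * m)) atTop (𝓝 (γ ^ j)) := by
    have := (hmul.tendsto_sub_pow h0 h1 hz (T := j) (q := id) j fun m => le_rfl).add (hγ.pow j)
    simpa using this
  have hs : Tendsto (fun m => a m (j * m % k)) atTop (𝓝 1) :=
    tendsto_of_tendsto_of_tendsto_of_le_of_le (hone k) tendsto_const_nhds
      (fun m => hanti m (Nat.mod_lt _ hk).le) (fun m => h1 _ _)
  have e2 := hmul j (fun m => k * (j * m / k)) (fun m => j * m % k)
    fun m => (Nat.div_add_mod _ _).le
  have e3 : Tendsto (fun m => a m (k * (j * m / k)) * (1 - a m (j * m % k))) atTop (𝓝 0) := by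
    have : Tendsto (fun m => 1 - a m (j * m % k)) atTop (𝓝 0) := by
      simpa using hs.const_sub 1
    refine squeeze_zero (fun m => mul_nonneg (h0 _ _) (sub_nonneg.2 (h1 _ _))) (fun m => ?_) this
    exact mul_le_of_le_one_left (sub_nonneg.2 (h1 _ _)) (h1 _ _)
  have e4 := hmul.tendsto_sub_pow h0 h1 hz (T := j) (q := fun m => j * m / k) k
    fun m => Nat.mul_div_le _ _
  have e5 : Tendsto (fun m => a m (j * m / k) ^ k) atTop (𝓝 (γ ^ j)) := by
    have := ((e1.sub e2).add e3).sub e4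
    simp only [sub_zero, add_zero] at this
    refine this.congr fun m => ?_
    rw [Nat.div_add_mod]
    ring
  have e6 := e5.rpow_const (p := (k : ℝ)⁻¹) (Or.inr (by positivity))
  have hk' : (k : ℝ) ≠ 0 := by positivity
  have : (γ ^ j) ^ ((k : ℝ)⁻¹) = γ ^ ((j : ℝ) / k) := by
    rw [← Real.rpow_natCast, ← Real.rpow_mul hγ0, div_eq_mul_inv]
  rw [this] at e6
  refine e6.congr fun m => ?_
  rw [Real.pow_rpow_inv_natCast (h0 _ _) hk.ne']

/-- A Pólya-type argument: both functions of `n` decrease, so convergence at finitely many multiples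
of `m / k` suffices, beyond the last of which both are small. -/
theorem AsympMultiplicative.eventually_abs_sub_rpow_le (hmul : AsympMultiplicative a)
    (h0 : ∀ m n, 0 ≤ a m n) (h1 : ∀ m n, a m n ≤ 1) (hz : ∀ m, a m 0 = 1)
    (hanti : ∀ m, Antitone (a m)) (hone : ∀ c, Tendsto (fun m => a m c) atTop (𝓝 1))
    {γ : ℝ} (hγ0 : 0 < γ) (hγ1 : γ < 1) (hγ : Tendsto (fun m => a m m) atTop (𝓝 γ))
    {ε : ℝ} (hε : 0 < ε) :
    ∀ᶠ m in atTop, ∀ n, |a m n - γ ^ ((n : ℝ) / m)| ≤ ε := by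
  have hanti_rpow : Antitone fun x : ℝ => γ ^ x :=
    Real.antitone_rpow_of_base_le_one hγ0 hγ1.le
  -- The mesh `1 / k` keeps the variation of `γ ^ x` over one cell below `ε / 2`; the cutoff `J / k`
  -- makes its tail at most `ε / 2`.
  obtain ⟨k, hk0, hk⟩ : ∃ k : ℕ, 0 < k ∧ 1 - ε / 2 ≤ γ ^ ((1 : ℝ) / k) := by
    have : Tendsto (fun k : ℕ => γ ^ ((1 : ℝ) / k)) atTop (𝓝 1) := by
      simpa [Function.comp_def] using ((Real.continuous_const_rpow hγ0.ne').tendsto 0).comp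
        (tendsto_one_div_atTop_nhds_zero_nat (𝕜 := ℝ))
    obtain ⟨k, hk, hk'⟩ := ((this.eventually (lt_mem_nhds (by linarith : 1 - ε / 2 < 1))).and
      (eventually_gt_atTop 0)).exists
    exact ⟨k, hk', hk.le⟩
  obtain ⟨J, hJ⟩ : ∃ J : ℕ, γ ^ ((J : ℝ) / k) ≤ ε / 2 := by
    have : Tendsto (fun j : ℕ => (γ ^ ((1 : ℝ) / k)) ^ j) atTop (𝓝 0) :=
      tendsto_pow_atTop_nhds_zero_of_lt_one (by positivity)
        (Real.rpow_lt_one hγ0.le hγ1 (by positivity))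
    obtain ⟨J, hJ⟩ := (this.eventually (gt_mem_nhds (half_pos hε))).exists
    refine ⟨J, ?_⟩
    rw [← Real.rpow_natCast, ← Real.rpow_mul hγ0.le] at hJ
    rw [one_div_mul_eq_div] at hJ
    exact hJ.le
  have hgrid : ∀ᶠ m in atTop, ∀ j ∈ Finset.range (J + 1),
      |a m (j * m / k) - γ ^ ((j : ℝ) / k)| < ε / 2 := by
    rw [Filter.eventually_all_finset]
    intro j _
    have := Metric.tendsto_nhds.1
      (hmul.tendsto_mul_div h0 h1 hz hanti hone hγ j hk0) (ε / 2) (half_pos hε)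
    simpa [Real.dist_eq] using this
  filter_upwards [hgrid, eventually_gt_atTop 0] with m hm hm0 n
  have hkR : (0 : ℝ) < k := by positivity
  have hmR : (0 : ℝ) < m := by positivity
  -- The grid cell of `n`: `j / k ≤ n / m < (j + 1) / k`.
  set j := n * k / m with hj
  have hj1 : j * m ≤ n * k := Nat.div_mul_le_self _ _
  have hj2 : n * k < (j + 1) * m := by
    rw [mul_comm (j + 1)]
    exact Nat.lt_mul_div_succ _ hm0
  have hjn : ∀ i, i ≤ j → i * m / k ≤ n ∧ γ ^ ((n : ℝ) / m) ≤ γ ^ ((i : ℝ) / k) := by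
    intro i hi
    have h : i * m ≤ n * k := (Nat.mul_le_mul_right m hi).trans hj1
    refine ⟨Nat.div_le_of_le_mul (by rwa [mul_comm k]), hanti_rpow ?_⟩
    rw [div_le_div_iff₀ hkR hmR]
    exact_mod_cast h
  rcases lt_or_ge j J with hlt | hge
  · have b1 := abs_lt.1 (hm j (by simp; omega))
    have b2 := abs_lt.1 (hm (j + 1) (by simp; omega))
    have c1 := hanti m (hjn j le_rfl).1
    have c2 := (hjn j le_rfl).2
    have c3 : a m ((j + 1) * m / k) ≤ a m n :=
      hanti m ((Nat.le_div_iff_mul_le hk0).2 hj2.le)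
    have c4 : γ ^ (((j + 1 : ℕ) : ℝ) / k) ≤ γ ^ ((n : ℝ) / m) := by
      refine hanti_rpow ?_
      rw [div_le_div_iff₀ hmR hkR]
      exact_mod_cast hj2.le
    have c5 : γ ^ ((j : ℝ) / k) - γ ^ (((j + 1 : ℕ) : ℝ) / k) ≤ ε / 2 := by
      have : γ ^ (((j + 1 : ℕ) : ℝ) / k) = γ ^ ((j : ℝ) / k) * γ ^ ((1 : ℝ) / k) := by
        rw [← Real.rpow_add hγ0]
        push_cast
        ring_nf
      have hle : γ ^ ((j : ℝ) / k) ≤ 1 := Real.rpow_le_one hγ0.le hγ1.le (by positivity)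
      have hpos : 0 < γ ^ ((j : ℝ) / k) := by positivity
      rw [this]
      nlinarith
    rw [abs_le]
    constructor <;> linarith [b1.1, b1.2, b2.1, b2.2]
  · have b1 := abs_lt.1 (hm J (by simp))
    have c1 := hanti m (hjn J hge).1
    have c2 := (hjn J hge).2
    have c3 := h0 m n
    have c4 : 0 ≤ γ ^ ((n : ℝ) / m) := by positivity
    rw [abs_le]
    constructor <;> linarith [b1.1, b1.2]

end Asymptotic

/-! ### From power asymptotics to a phantom distribution function -/

theorem rpow_div_sub_rpow_div_le {γ : ℝ} (hγ0 : 0 < γ) (m n : ℕ) :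
    γ ^ ((n : ℝ) / ((m + 1 : ℕ) + 1 : ℕ)) - γ ^ ((n : ℝ) / (m + 1 : ℕ)) ≤ 1 / (m + 1 : ℕ) := by
  set z := γ ^ ((n : ℝ) / ((m + 1 : ℕ) + 1 : ℕ)) with hz
  have hz0 : 0 ≤ z := by positivity
  have hc : (0 : ℝ) < 1 / (m + 1 : ℕ) := by positivity
  have h : γ ^ ((n : ℝ) / (m + 1 : ℕ)) = z ^ (1 + 1 / (m + 1 : ℕ) : ℝ) := by
    rw [hz, ← Real.rpow_mul hγ0.le]
    congr 1
    push_cast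
    field_simp
  -- Bernoulli with `c = 1 / (m + 1)` gives `z - z ^ (1 + c) ≤ c * (1 - z) ≤ c`, a bound independent
  -- of `n`.
  have hb := one_add_mul_self_le_rpow_one_add (s := z - 1) (by linarith)
    (p := 1 + 1 / (m + 1 : ℕ)) (by linarith)
  rw [add_sub_cancel] at hb
  rw [h]
  nlinarith

/-- If `A n (v m)` is uniformly close to `γ ^ (n / (m + 1))`, a continuous distribution function
interpolating `γ ^ (1 / (m + 1))` at `v m` approximates `A n` by its powers. -/
theorem exists_continuous_df_pow_approx {A : ℕ → ℝ → ℝ} (hA0 : ∀ n u, 0 ≤ A n u)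
    (hA1 : ∀ n u, A n u ≤ 1) (hA : ∀ n, Monotone (A n)) {v : ℕ → ℝ} (hv : StrictMono v)
    {γ : ℝ} (hγ0 : 0 < γ) (hγ1 : γ < 1)
    (happ : ∀ ε > 0, ∀ᶠ m : ℕ in atTop, ∀ n : ℕ,
      |A n (v m) - γ ^ ((n : ℝ) / (m + 1 : ℕ))| ≤ ε) :
    ∃ G : ℝ → ℝ, Continuous G ∧ IsDistributionFunction G ∧
      ∀ ε > 0, ∀ᶠ n in atTop, ∀ u, |A n u - G u ^ n| ≤ ε := by
  have hanti_rpow : Antitone fun x : ℝ => γ ^ x :=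
    Real.antitone_rpow_of_base_le_one hγ0 hγ1.le
  have hg1 : Tendsto (fun m : ℕ => γ ^ ((1 : ℝ) / (m + 1 : ℕ))) atTop (𝓝 1) := by
    simpa [Function.comp_def] using ((Real.continuous_const_rpow hγ0.ne').tendsto 0).comp
      ((tendsto_one_div_atTop_nhds_zero_nat (𝕜 := ℝ)).comp (tendsto_add_atTop_nat 1))
  obtain ⟨G, hGc, hG, hGv⟩ := exists_continuous_isDistributionFunction_interpolating
    (g := fun m : ℕ => γ ^ ((1 : ℝ) / (m + 1 : ℕ))) hv
    (fun m m' h => hanti_rpow (by gcongr)) (by positivity) hg1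
  have hG0 : ∀ u, 0 ≤ G u := fun u => hG.mono.le_of_tendsto hG.tendsto_atBot u
  have hG1 : ∀ u, G u ≤ 1 := fun u => hG.mono.ge_of_tendsto hG.tendsto_atTop u
  have hGvn : ∀ m n : ℕ, G (v m) ^ n = γ ^ ((n : ℝ) / (m + 1 : ℕ)) := fun m n => by
    rw [hGv, ← Real.rpow_natCast, ← Real.rpow_mul hγ0.le]
    ring_nf
  have hGmono : ∀ n {x y : ℝ}, x ≤ y → G x ^ n ≤ G y ^ n := fun n x y h =>
    pow_le_pow_left₀ (hG0 x) (hG.mono h) n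
  refine ⟨G, hGc, hG, fun ε hε => ?_⟩
  have hstep : ∀ᶠ m : ℕ in atTop, (1 : ℝ) / (m + 1 : ℕ) ≤ ε / 2 := by
    have := (tendsto_one_div_atTop_nhds_zero_nat (𝕜 := ℝ)).comp (tendsto_add_atTop_nat 1)
    filter_upwards [this.eventually (gt_mem_nhds (half_pos hε))] with m hm using hm.le
  obtain ⟨M, hM⟩ := eventually_atTop.1 ((happ (ε / 2) (half_pos hε)).and hstep)
  have hsmall : ∀ᶠ n in atTop, G (v M) ^ n < ε / 2 := by
    have hlt : G (v M) < 1 := by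
      rw [hGv]
      exact Real.rpow_lt_one hγ0.le hγ1 (by positivity)
    exact (tendsto_pow_atTop_nhds_zero_of_lt_one (hG0 _) hlt).eventually
      (gt_mem_nhds (half_pos hε))
  filter_upwards [hsmall] with n hn u
  have hAv : ∀ m ≥ M, |A n (v m) - G (v m) ^ n| ≤ ε / 2 := fun m hm => by
    rw [hGvn]
    exact (hM m hm).1 n
  by_cases hu : ∃ m, u < v m
  · classical
    have hfind := Nat.find_spec hu
    -- Below `v M` both quantities are small because `G (v M) ^ n` is; otherwise `u` lies between
    -- two consecutive nodes of index at least `M`.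
    rcases le_or_gt (Nat.find hu) M with hle | hgt
    · have huM : u ≤ v M := hfind.le.trans (hv.monotone hle)
      have b1 := abs_le.1 (hAv M le_rfl)
      have b2 := hA n huM
      have b3 := hGmono n huM
      have b4 := hA0 n u
      have b5 := pow_nonneg (hG0 u) n
      rw [abs_le]
      constructor <;> linarith [b1.1, b1.2]
    · obtain ⟨m, hm⟩ : ∃ m, Nat.find hu = m + 1 := ⟨Nat.find hu - 1, by omega⟩
      rw [hm] at hfind hgt
      have hmu : v m ≤ u := not_lt.1 (Nat.find_min hu (by omega : m < Nat.find hu))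
      have hMm : M ≤ m := by omega
      have b1 := abs_le.1 (hAv m hMm)
      have b2 := abs_le.1 (hAv (m + 1) (hMm.trans m.le_succ))
      have b3 := hA n hmu
      have b4 := hA n hfind.le
      have b5 := hGmono n hmu
      have b6 := hGmono n hfind.le
      have b7 : G (v (m + 1)) ^ n - G (v m) ^ n ≤ ε / 2 := by
        rw [hGvn, hGvn]
        exact (rpow_div_sub_rpow_div_le hγ0 m n).trans (hM m hMm).2
      rw [abs_le]
      constructor <;> linarith [b1.1, b1.2, b2.1, b2.2]
  -- Here `u` lies above every `v m`. With `n` fixed, `G (v m) ^ n` tends to 1 as `m` grows, so both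
  -- quantities are near 1.
  · push Not at hu
    have hlim : Tendsto (fun m => G (v m) ^ n) atTop (𝓝 1) := by
      have := hg1.pow n
      rw [one_pow] at this
      exact this.congr fun m => by rw [hGv]
    obtain ⟨m, hm1, hm2⟩ := ((hlim.eventually
      (lt_mem_nhds (by linarith : 1 - ε / 2 < 1))).and (eventually_ge_atTop M)).exists
    have b1 := abs_le.1 (hAv m hm2)
    have b3 := hA n (hu m)
    have b5 := hGmono n (hu m)
    have b6 := hA1 n u
    have b7 : G u ^ n ≤ 1 := pow_le_one₀ (hG0 u) (hG1 u)
    rw [abs_le]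
    constructor <;> linarith [b1.1, b1.2]

/-! ### Lipschitz smoothing of indicators -/

section Ramp

/-- The `δ⁻¹`-Lipschitz function equal to `1` on `(-∞, u]` and to `0` on `[u + δ, ∞)`. -/
noncomputable def ramp (u δ x : ℝ) : ℝ := max 0 (min 1 ((u + δ - x) / δ))

variable {u δ : ℝ}

theorem ramp_nonneg (u δ x : ℝ) : 0 ≤ ramp u δ x := le_max_left _ _

theorem ramp_le_one (u δ x : ℝ) : ramp u δ x ≤ 1 := max_le zero_le_one (min_le_left _ _)

theorem measurable_ramp (u δ : ℝ) : Measurable (ramp u δ) := by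
  unfold ramp
  fun_prop

theorem ramp_eq_one (hδ : 0 < δ) {x : ℝ} (hx : x ≤ u) : ramp u δ x = 1 := by
  have : 1 ≤ (u + δ - x) / δ := by
    rw [one_le_div hδ]; linarith
  rw [ramp, min_eq_left this, max_eq_right zero_le_one]

theorem ramp_eq_zero (hδ : 0 < δ) {x : ℝ} (hx : u + δ ≤ x) : ramp u δ x = 0 :=
  max_eq_left ((min_le_right _ _).trans
    (div_nonpos_of_nonpos_of_nonneg (sub_nonpos.2 hx) hδ.le))

theorem abs_ramp_sub_ramp_le (hδ : 0 < δ) (x y : ℝ) :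
    |ramp u δ y - ramp u δ x| ≤ δ⁻¹ * |y - x| := by
  have h1 : |ramp u δ y - ramp u δ x| ≤ |(u + δ - y) / δ - (u + δ - x) / δ| := by
    unfold ramp
    refine (abs_max_sub_max_le_max _ _ _ _).trans ?_
    rw [sub_self, abs_zero, max_eq_right (abs_nonneg _)]
    refine (abs_min_sub_min_le_max _ _ _ _).trans ?_
    rw [sub_self, abs_zero, max_eq_right (abs_nonneg _)]
  refine h1.trans_eq ?_
  rw [← sub_div, abs_div, abs_of_pos hδ, div_eq_inv_mul, abs_sub_comm]
  congr 2
  ring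

/-- Replacing the factors one at a time costs one difference each, as all other factors lie in `[0,
1]`. Hence a product of ramps keeps the `ℓ¹` Lipschitz constant `δ⁻¹` in every dimension. -/
theorem abs_prod_sub_prod_le {ι : Type*} (s : Finset ι) {a b : ι → ℝ}
    (ha0 : ∀ i, 0 ≤ a i) (ha1 : ∀ i, a i ≤ 1) (hb0 : ∀ i, 0 ≤ b i) (hb1 : ∀ i, b i ≤ 1) :
    |∏ i ∈ s, a i - ∏ i ∈ s, b i| ≤ ∑ i ∈ s, |a i - b i| := by
  classical
  induction s using Finset.induction_on with
  | empty => simp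
  | insert i s hi ih =>
    rw [Finset.prod_insert hi, Finset.prod_insert hi, Finset.sum_insert hi]
    have h1 : a i * ∏ j ∈ s, a j - b i * ∏ j ∈ s, b j =
      (a i - b i) * ∏ j ∈ s, a j + b i * (∏ j ∈ s, a j - ∏ j ∈ s, b j) := by ring
    have h2 : ∏ j ∈ s, a j ≤ 1 := Finset.prod_le_one (fun j _ => ha0 j) fun j _ => ha1 j
    have h3 : 0 ≤ ∏ j ∈ s, a j := Finset.prod_nonneg fun j _ => ha0 j
    rw [h1]
    refine (abs_add_le _ _).trans (add_le_add ?_ (le_trans ?_ ih))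
    · rw [abs_mul, abs_of_nonneg h3]
      exact mul_le_of_le_one_right (abs_nonneg _) h2
    · rw [abs_mul, abs_of_nonneg (hb0 i)]
      exact mul_le_of_le_one_left (abs_nonneg _) (hb1 i)

/-- The product of ramps, a smooth version of the indicator of `∀ i, x i ≤ u`. -/
noncomputable def rampProd (u δ : ℝ) (s : ℕ) (x : Fin s → ℝ) : ℝ := ∏ i, ramp u δ (x i)

theorem isTestFunction_rampProd (hδ : 0 < δ) {s : ℕ} (hs : 0 < s) :
    IsTestFunction (rampProd u δ s) where
  measurable := by
    unfold rampProd
    exact Finset.measurable_prod _ fun i _ => (measurable_ramp u δ).comp (measurable_pi_apply i)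
  abs_le_one x := by
    rw [rampProd, abs_of_nonneg (Finset.prod_nonneg fun i _ => ramp_nonneg _ _ _)]
    exact Finset.prod_le_one (fun i _ => ramp_nonneg _ _ _) fun i _ => ramp_le_one _ _ _
  nonconstant := by
    refine ⟨fun _ => u, fun _ => u + δ, ?_⟩
    simp [rampProd, ramp_eq_one hδ le_rfl, ramp_eq_zero hδ le_rfl, hs.ne']

theorem lip_rampProd_le (hδ : 0 < δ) (s : ℕ) : lip (rampProd u δ s) ≤ ENNReal.ofReal δ⁻¹ := by
  refine iSup_le fun x => iSup_le fun y => iSup_le fun _ => ?_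
  refine ENNReal.div_le_of_le_mul ?_
  rw [← ENNReal.ofReal_mul (by positivity), Finset.mul_sum]
  refine ENNReal.ofReal_le_ofReal ?_
  refine (abs_prod_sub_prod_le _ (fun i => ramp_nonneg _ _ _) (fun i => ramp_le_one _ _ _)
    (fun i => ramp_nonneg _ _ _) (fun i => ramp_le_one _ _ _)).trans ?_
  exact Finset.sum_le_sum fun i _ => abs_ramp_sub_ramp_le hδ _ _

theorem lambdaWeight_rampProd_le (hδ : 0 < δ) (s t : ℕ) :
    lambdaWeight s t (rampProd u δ s) (rampProd u δ t) ≤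
      ENNReal.ofReal ((s + t : ℕ) * δ⁻¹ + s * t * δ⁻¹ ^ 2) := by
  have hδ' : 0 ≤ δ⁻¹ := by positivity
  have h : ENNReal.ofReal ((s + t : ℕ) * δ⁻¹ + s * t * δ⁻¹ ^ 2) =
      (s : ℝ≥0∞) * ENNReal.ofReal δ⁻¹ + t * ENNReal.ofReal δ⁻¹ +
        s * t * ENNReal.ofReal δ⁻¹ * ENNReal.ofReal δ⁻¹ := by
    rw [← ENNReal.ofReal_natCast s, ← ENNReal.ofReal_natCast t,
      ← ENNReal.ofReal_mul (by positivity), ← ENNReal.ofReal_mul (by positivity),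
      ← ENNReal.ofReal_mul (by positivity), ← ENNReal.ofReal_mul (by positivity),
      ← ENNReal.ofReal_mul (by positivity), ← ENNReal.ofReal_add (by positivity) (by positivity),
      ← ENNReal.ofReal_add (by positivity) (by positivity)]
    congr 1
    push_cast
    ring
  rw [h, lambdaWeight]
  gcongr <;> exact lip_rampProd_le hδ _

end Ramp

/-! ### Probabilities that blocks stay below a level -/

section ProbLe

variable {Ω : Type*} [MeasurableSpace Ω] {P : Measure Ω} {X : ℕ → Ω → ℝ}

/-- The probability that `X j ≤ u` for all `j ∈ S`. -/
noncomputable def probLe (P : Measure Ω) (X : ℕ → Ω → ℝ) (S : Finset ℕ) (u : ℝ) : ℝ :=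
  P.real {ω | ∀ j ∈ S, X j ω ≤ u}

theorem measurableSet_forall_le (hX : ∀ j, Measurable (X j)) (S : Finset ℕ) (u : ℝ) :
    MeasurableSet {ω | ∀ j ∈ S, X j ω ≤ u} := by
  have : {ω | ∀ j ∈ S, X j ω ≤ u} = ⋂ j ∈ S, {ω | X j ω ≤ u} := by ext; simp
  rw [this]
  exact S.measurableSet_biInter fun j _ => measurableSet_le (hX j) measurable_const

theorem probLe_nonneg (S : Finset ℕ) (u : ℝ) : 0 ≤ probLe P X S u := measureReal_nonneg

theorem measureReal_partialMax_le {n : ℕ} (hn : 0 < n) (u : ℝ) :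
    P.real {ω | partialMax X n ω ≤ u} = probLe P X (Finset.range n) u := by
  have : Nonempty (Fin n) := ⟨⟨0, hn⟩⟩
  unfold probLe partialMax
  congr 1
  ext ω
  rw [Set.mem_ofPred_eq, ciSup_le_iff (Set.finite_range _).bddAbove]
  simp [Fin.forall_iff]

theorem StrictlyStationary.probLe_Ico (hstat : StrictlyStationary P X)
    (hX : ∀ j, Measurable (X j)) (k n : ℕ) (u : ℝ) :
    probLe P X (Finset.Ico k (k + n)) u = probLe P X (Finset.range n) u := by
  have hs : MeasurableSet {x : ℕ → ℝ | ∀ j ∈ Finset.range n, x j ≤ u} :=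
    measurableSet_forall_le (fun j => measurable_pi_apply j) _ _
  have h := congrArg (fun μ => μ.real {x : ℕ → ℝ | ∀ j ∈ Finset.range n, x j ≤ u}) (hstat k)
  beta_reduce at h
  rw [map_measureReal_apply (measurable_pi_lambda _ fun j => hX _) hs,
    map_measureReal_apply (measurable_pi_lambda _ fun j => hX _) hs] at h
  refine Eq.trans ?_ h
  unfold probLe
  congr 1
  ext ω
  simp only [Set.mem_ofPred_eq, Set.mem_preimage, Finset.mem_Ico, Finset.mem_range]
  refine ⟨fun H j hj => H _ (by omega), fun H j hj => ?_⟩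
  have := H (j - k) (by omega)
  rwa [Nat.sub_add_cancel hj.1] at this

variable [IsProbabilityMeasure P]

theorem probLe_le_one (S : Finset ℕ) (u : ℝ) : probLe P X S u ≤ 1 := measureReal_le_one

theorem probLe_empty (u : ℝ) : probLe P X ∅ u = 1 := by simp [probLe]

theorem probLe_mono (S : Finset ℕ) : Monotone (probLe P X S) := fun _ _ h =>
  measureReal_mono fun _ hω j hj => (hω j hj).trans h

theorem probLe_anti {S S' : Finset ℕ} (h : S ⊆ S') (u : ℝ) : probLe P X S' u ≤ probLe P X S u :=
  measureReal_mono fun _ hω j hj => hω j (h hj)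

/-- Imposing the extra constraints in `S'` loses at most the probability that one of them fails. -/
theorem probLe_le_union_add (hX : ∀ j, Measurable (X j)) (S S' : Finset ℕ) (u : ℝ) :
    probLe P X S u ≤ probLe P X (S ∪ S') u + (1 - probLe P X S' u) := by
  have h1 : 1 - probLe P X S' u = P.real {ω | ∀ j ∈ S', X j ω ≤ u}ᶜ :=
    (probReal_compl_eq_one_sub (measurableSet_forall_le hX S' u)).symm
  rw [h1]
  refine (measureReal_mono fun ω hω => ?_).trans (measureReal_union_le _ _)
  by_cases h : ∀ j ∈ S', X j ω ≤ u
  · refine Or.inl fun j hj => ?_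
    rcases Finset.mem_union.1 hj with hj | hj
    exacts [hω j hj, h j hj]
  · exact Or.inr h

theorem StrictlyStationary.measureReal_le (hstat : StrictlyStationary P X)
    (hX : ∀ j, Measurable (X j)) (j : ℕ) (u : ℝ) :
    P.real {ω | X j ω ≤ u} = cdf (P.map (X 0)) u := by
  have := Measure.isProbabilityMeasure_map (μ := P) (hX 0).aemeasurable
  rw [cdf_eq_real, map_measureReal_apply (hX 0) measurableSet_Iic]
  have := hstat.probLe_Ico hX j 1 u
  simpa [probLe, Set.preimage] using this

theorem StrictlyStationary.probLe_sub_le (hstat : StrictlyStationary P X)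
    (hX : ∀ j, Measurable (X j)) (S : Finset ℕ) {x y : ℝ} (hxy : x ≤ y) :
    probLe P X S y - probLe P X S x ≤
      S.card * (cdf (P.map (X 0)) y - cdf (P.map (X 0)) x) := by
  have h1 : ∀ j, P.real ({ω | X j ω ≤ y} \ {ω | X j ω ≤ x}) =
      cdf (P.map (X 0)) y - cdf (P.map (X 0)) x := fun j => by
    rw [measureReal_sdiff (Set.ofPred_subset_ofPred.2 fun ω hω => le_trans hω hxy)
      (measurableSet_le (hX j) measurable_const),
      hstat.measureReal_le hX, hstat.measureReal_le hX]
  have h2 : probLe P X S y ≤ probLe P X S x +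
      P.real (⋃ j ∈ S, {ω | X j ω ≤ y} \ {ω | X j ω ≤ x}) := by
    refine (measureReal_mono fun ω hω => ?_).trans (measureReal_union_le _ _)
    by_cases h : ∀ j ∈ S, X j ω ≤ x
    · exact Or.inl h
    · push Not at h
      obtain ⟨j, hj, hjx⟩ := h
      exact Or.inr (Set.mem_biUnion hj ⟨hω j hj, not_le.2 hjx⟩)
  have h3 := measureReal_biUnion_finset_le (μ := P) S
    fun j => {ω | X j ω ≤ y} \ {ω | X j ω ≤ x}
  simp only [h1, Finset.sum_const, nsmul_eq_mul] at h3
  linarith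

theorem StrictlyStationary.continuous_probLe (hstat : StrictlyStationary P X)
    (hX : ∀ j, Measurable (X j)) (hcont : Continuous (cdf (P.map (X 0)))) (S : Finset ℕ) :
    Continuous (probLe P X S) := by
  have key : ∀ x y, |probLe P X S y - probLe P X S x| ≤
      S.card * |cdf (P.map (X 0)) y - cdf (P.map (X 0)) x| := by
    have : ∀ x y, x ≤ y → |probLe P X S y - probLe P X S x| ≤
        S.card * |cdf (P.map (X 0)) y - cdf (P.map (X 0)) x| := fun x y h => by
      rw [abs_of_nonneg (sub_nonneg.2 (probLe_mono S h)),
        abs_of_nonneg (sub_nonneg.2 (monotone_cdf _ h))]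
      exact hstat.probLe_sub_le hX S h
    intro x y
    rcases le_total x y with h | h
    · exact this x y h
    · rw [abs_sub_comm, abs_sub_comm (cdf _ y)]
      exact this y x h
  refine continuous_iff_continuousAt.2 fun x => tendsto_iff_norm_sub_tendsto_zero.2 ?_
  have h0 : Tendsto (fun y => (S.card : ℝ) * |cdf (P.map (X 0)) y - cdf (P.map (X 0)) x|)
      (𝓝 x) (𝓝 0) := by
    have : Continuous fun y => (S.card : ℝ) * |cdf (P.map (X 0)) y - cdf (P.map (X 0)) x| := by
      fun_prop
    simpa using this.tendsto x
  exact squeeze_zero (fun _ => norm_nonneg _) (fun y => key x y) h0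

/-- Intermediate value theorem: continuity is inherited from the marginal through a union bound. -/
theorem StrictlyStationary.exists_probLe_eq (hstat : StrictlyStationary P X)
    (hX : ∀ j, Measurable (X j)) (hcont : Continuous (cdf (P.map (X 0)))) {n : ℕ} (hn : 0 < n)
    {c : ℝ} (hc0 : 0 < c) (hc1 : c < 1) : ∃ u, probLe P X (Finset.range n) u = c := by
  have hle : ∀ u, probLe P X (Finset.range n) u ≤ cdf (P.map (X 0)) u := fun u => by
    have := probLe_anti (P := P) (X := X) (Finset.range_mono hn : Finset.range 1 ⊆ _) u
    rw [← hstat.measureReal_le hX 0 u]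
    simpa [probLe] using this
  have hlim : Tendsto (fun y => P.real {ω | ∀ j ∈ Finset.range n, X j ω ≤ y}) atTop (𝓝 1) := by
    have hm : Monotone fun y : ℝ => {ω | ∀ j ∈ Finset.range n, X j ω ≤ y} :=
      fun _ _ h _ hω j hj => (hω j hj).trans h
    have h1 := tendsto_measure_iUnion_atTop (μ := P) hm
    have h2 : ⋃ y : ℝ, {ω | ∀ j ∈ Finset.range n, X j ω ≤ y} = Set.univ := by
      refine Set.eq_univ_of_forall fun ω => Set.mem_iUnion.2 ?_
      obtain ⟨y, hy⟩ := ((Finset.range n).image fun j => X j ω).bddAbove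
      exact ⟨y, fun j hj => hy (by simpa using ⟨j, by simpa using hj, rfl⟩)⟩
    rw [h2, measure_univ] at h1
    exact (ENNReal.tendsto_toReal ENNReal.one_ne_top).comp h1
  refine mem_range_of_exists_le_of_exists_ge (hstat.continuous_probLe hX hcont _) ?_ ?_
  · obtain ⟨u, hu⟩ := ((tendsto_cdf_atBot (P.map (X 0))).eventually (gt_mem_nhds hc0)).exists
    exact ⟨u, (hle u).trans hu.le⟩
  · obtain ⟨u, hu⟩ := (hlim.eventually (lt_mem_nhds hc1)).exists
    exact ⟨u, hu.le⟩

theorem integrable_prod_ramp (hX : ∀ j, Measurable (X j)) (S : Finset ℕ) (u δ : ℝ) :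
    Integrable (fun ω => ∏ j ∈ S, ramp u δ (X j ω)) P := by
  refine Integrable.of_bound (Finset.measurable_fun_prod _ fun j _ =>
    (measurable_ramp u δ).comp (hX j)).aestronglyMeasurable 1 (Eventually.of_forall fun ω => ?_)
  rw [Real.norm_of_nonneg (Finset.prod_nonneg fun i _ => ramp_nonneg _ _ _)]
  exact Finset.prod_le_one (fun i _ => ramp_nonneg _ _ _) fun i _ => ramp_le_one _ _ _

theorem probLe_le_integral_prod_ramp (hX : ∀ j, Measurable (X j)) (S : Finset ℕ) (u : ℝ)
    {δ : ℝ} (hδ : 0 < δ) : probLe P X S u ≤ ∫ ω, ∏ j ∈ S, ramp u δ (X j ω) ∂P := by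
  rw [probLe, ← integral_indicator_one (measurableSet_forall_le hX S u)]
  refine integral_mono ((integrable_const 1).indicator (measurableSet_forall_le hX S u))
    (integrable_prod_ramp hX S u δ) fun ω => ?_
  by_cases h : ∀ j ∈ S, X j ω ≤ u
  · rw [Set.indicator_of_mem (by exact h)]
    exact (Finset.prod_eq_one fun j hj => ramp_eq_one hδ (h j hj)).ge
  · rw [Set.indicator_of_notMem (by exact h)]
    exact Finset.prod_nonneg fun i _ => ramp_nonneg _ _ _

theorem integral_prod_ramp_le_probLe (hX : ∀ j, Measurable (X j)) (S : Finset ℕ) (u : ℝ)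
    {δ : ℝ} (hδ : 0 < δ) : ∫ ω, ∏ j ∈ S, ramp u δ (X j ω) ∂P ≤ probLe P X S (u + δ) := by
  rw [probLe, ← integral_indicator_one (measurableSet_forall_le hX S _)]
  refine integral_mono (integrable_prod_ramp hX S u δ)
    ((integrable_const 1).indicator (measurableSet_forall_le hX S _)) fun ω => ?_
  by_cases h : ∀ j ∈ S, X j ω ≤ u + δ
  · rw [Set.indicator_of_mem (by exact h)]
    exact Finset.prod_le_one (fun i _ => ramp_nonneg _ _ _) fun i _ => ramp_le_one _ _ _
  · rw [Set.indicator_of_notMem (by exact h)]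
    push Not at h
    obtain ⟨j, hj, hjx⟩ := h
    exact (Finset.prod_eq_zero hj (ramp_eq_zero hδ hjx.le)).le

end ProbLe

/-! ### Decoupling of blocks and the phantom distribution function -/

section Decoupling

variable {Ω : Type*} [MeasurableSpace Ω] {P : Measure Ω} {X : ℕ → Ω → ℝ}

theorem abs_cov_le_of_dependenceCoeff_le {Ψ : Weight} {r : ℕ} {L W : ℝ} (hL0 : 0 ≤ L)
    (hL : dependenceCoeff Ψ P X r ≤ ENNReal.ofReal L) {s t : ℕ} {f : (Fin s → ℝ) → ℝ}
    {g : (Fin t → ℝ) → ℝ} (hf : IsTestFunction f) (hg : IsTestFunction g) {i : Fin s → ℕ}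
    {j : Fin t → ℕ} (hi : Monotone i) (hj : Monotone j) (hij : ∀ a b, i a + r ≤ j b)
    (hW0 : 0 ≤ W) (hW : Ψ s t f g ≤ ENNReal.ofReal W) :
    |cov[fun ω => f (fun a => X (i a) ω), fun ω => g (fun a => X (j a) ω); P]| ≤ L * W := by
  have h1 : ENNReal.ofReal |cov[fun ω => f (fun a => X (i a) ω),
      fun ω => g (fun a => X (j a) ω); P]| / Ψ s t f g ≤ ENNReal.ofReal L := by
    refine le_trans ?_ hL
    unfold dependenceCoeff
    refine le_iSup_of_le s (le_iSup_of_le t (le_iSup_of_le f (le_iSup_of_le g ?_)))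
    refine le_iSup_of_le hf (le_iSup_of_le hg (le_iSup_of_le i (le_iSup_of_le j ?_)))
    exact le_iSup_of_le hi (le_iSup_of_le hj (le_iSup_of_le hij le_rfl))
  rw [ENNReal.div_le_iff_le_mul (Or.inr ENNReal.ofReal_ne_top)
    (Or.inl (ne_top_of_le_ne_top ENNReal.ofReal_ne_top hW))] at h1
  have h2 := h1.trans (mul_le_mul_right hW _)
  rw [← ENNReal.ofReal_mul hL0] at h2
  exact (ENNReal.ofReal_le_ofReal_iff (mul_nonneg hL0 hW0)).1 h2

variable [IsProbabilityMeasure P]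

/-- Asymptotic independence of `max` over two blocks of lengths `p` and `q` separated by a gap
of length `r`. -/
theorem StrictlyStationary.abs_probLe_union_sub_mul_le (hstat : StrictlyStationary P X)
    (hX : ∀ j, Measurable (X j)) {Ψ : Weight} (hΨ : ∀ s t f g, Ψ s t f g ≤ lambdaWeight s t f g)
    {r : ℕ} {L : ℝ} (hL0 : 0 ≤ L) (hL : dependenceCoeff Ψ P X r ≤ ENNReal.ofReal L)
    {δ : ℝ} (hδ : 0 < δ) (p q : ℕ) (u : ℝ) :
    |probLe P X (Finset.range p ∪ Finset.Ico (p + r) (p + r + q)) u -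
        probLe P X (Finset.range p) u * probLe P X (Finset.range q) u| ≤
      (p + q : ℕ) * (cdf (P.map (X 0)) (u + δ) - cdf (P.map (X 0)) u) +
        L * ((p + q : ℕ) * δ⁻¹ + p * q * δ⁻¹ ^ 2) := by
  have hF : 0 ≤ cdf (P.map (X 0)) (u + δ) - cdf (P.map (X 0)) u :=
    sub_nonneg.2 (monotone_cdf _ (by linarith))
  have hrhs : 0 ≤ (p + q : ℕ) * (cdf (P.map (X 0)) (u + δ) - cdf (P.map (X 0)) u) +
      L * ((p + q : ℕ) * δ⁻¹ + p * q * δ⁻¹ ^ 2) := by positivity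
  -- An empty product of ramps is constant and hence not a test function, so empty blocks are
  -- treated apart.
  rcases p.eq_zero_or_pos with rfl | hp
  · rw [Finset.range_zero, Finset.empty_union, hstat.probLe_Ico hX, probLe_empty, one_mul,
      sub_self, abs_zero]
    exact hrhs
  rcases q.eq_zero_or_pos with rfl | hq
  · rw [add_zero, Finset.Ico_self, Finset.union_empty, Finset.range_zero, probLe_empty, mul_one,
      sub_self, abs_zero]
    exact hrhs
  set S := Finset.range p
  set S' := Finset.Ico (p + r) (p + r + q)
  have hdisj : Disjoint S S' := by
    rw [Finset.disjoint_left]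
    intro a ha ha'
    simp only [S, S', Finset.mem_range, Finset.mem_Ico] at ha ha'
    omega
  set f : Finset ℕ → Ω → ℝ := fun U ω => ∏ j ∈ U, ramp u δ (X j ω)
  have hf : (fun ω => rampProd u δ p fun a => X a ω) = f S := by
    ext ω
    exact Fin.prod_univ_eq_prod_range (fun j => ramp u δ (X j ω)) p
  have hg : (fun ω => rampProd u δ q fun a => X (p + r + a) ω) = f S' := by
    ext ω
    simp only [f, S']
    rw [Finset.prod_Ico_eq_prod_range, Nat.add_sub_cancel_left]
    exact Fin.prod_univ_eq_prod_range (fun j => ramp u δ (X (p + r + j) ω)) q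
  have hcov := abs_cov_le_of_dependenceCoeff_le hL0 hL (isTestFunction_rampProd (u := u) hδ hp)
    (isTestFunction_rampProd (u := u) hδ hq) (i := fun a => (a : ℕ)) (j := fun a => p + r + a)
    (fun a b h => h) (fun a b h => Nat.add_le_add_left h _) (fun a b => by omega)
    (W := (p + q : ℕ) * δ⁻¹ + p * q * δ⁻¹ ^ 2) (by positivity)
    ((hΨ _ _ _ _).trans (lambdaWeight_rampProd_le hδ p q))
  have hbd : ∀ U, MemLp (f U) 2 P := fun U => by
    refine MemLp.of_bound (integrable_prod_ramp hX U u δ).aestronglyMeasurable 1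
      (Eventually.of_forall fun ω => ?_)
    rw [Real.norm_of_nonneg (Finset.prod_nonneg fun i _ => ramp_nonneg _ _ _)]
    exact Finset.prod_le_one (fun i _ => ramp_nonneg _ _ _) fun i _ => ramp_le_one _ _ _
  rw [hf, hg, covariance_eq_sub (hbd S) (hbd S')] at hcov
  have hmul : f S * f S' = f (S ∪ S') := by
    ext ω
    exact (Finset.prod_union hdisj).symm
  rw [hmul] at hcov
  -- Each smoothed expectation exceeds the true probability by at most `U.card` times the marginal
  -- increment over `[u, u + δ]`.
  have lo : ∀ U, probLe P X U u ≤ P[f U] := fun U => probLe_le_integral_prod_ramp hX U u hδ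
  have hi : ∀ U, P[f U] ≤ probLe P X U u +
      U.card * (cdf (P.map (X 0)) (u + δ) - cdf (P.map (X 0)) u) := fun U => by
    have h1 := integral_prod_ramp_le_probLe (P := P) hX U u hδ
    have h2 := hstat.probLe_sub_le hX U (by linarith : u ≤ u + δ)
    linarith
  have hcS : S.card = p := Finset.card_range p
  have hcS' : S'.card = q := by simp [S']
  have hcU : (S ∪ S').card = p + q := by rw [Finset.card_union_of_disjoint hdisj, hcS, hcS']
  have l1 := lo S
  have l2 := lo S'
  have l3 := lo (S ∪ S')
  have u1 := hi S
  have u2 := hi S'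
  have u3 := hi (S ∪ S')
  rw [hcS] at u1
  rw [hcS'] at u2
  rw [hcU] at u3
  have hS' : probLe P X S' u = probLe P X (Finset.range q) u := hstat.probLe_Ico hX _ _ _
  rw [← hS']
  have z1 := probLe_nonneg (P := P) (X := X) S u
  have z2 := probLe_nonneg (P := P) (X := X) S' u
  have o1 := probLe_le_one (P := P) (X := X) S u
  have o2 : P[f S'] ≤ 1 := (integral_prod_ramp_le_probLe hX S' u hδ).trans (probLe_le_one _ _)
  set c := cdf (P.map (X 0)) (u + δ) - cdf (P.map (X 0)) u
  have m1 : probLe P X S u * probLe P X S' u ≤ P[f S] * P[f S'] :=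
    mul_le_mul l1 l2 z2 (z1.trans l1)
  have m2 : P[f S] * P[f S'] ≤ probLe P X S u * probLe P X S' u + (p + q : ℕ) * c := by
    have e1 : (P[f S] - probLe P X S u) * P[f S'] ≤ p * c :=
      (mul_le_of_le_one_right (sub_nonneg.2 l1) o2).trans (by linarith)
    have e2 : probLe P X S u * (P[f S'] - probLe P X S' u) ≤ q * c :=
      (mul_le_of_le_one_left (sub_nonneg.2 l2) o1).trans (by linarith)
    push_cast
    linarith
  have := abs_le.1 hcov
  rw [abs_le]
  constructor <;> linarith [this.1, this.2]

/-- Blocks of total length `O(m)` separated by gaps of length `r m = o(m)` are asymptotically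
independent for the events that all variables are at most `u`, uniformly in `u`. -/
structure AsympDecoupled (P : Measure Ω) (X : ℕ → Ω → ℝ) (r : ℕ → ℕ) : Prop where
  tendsto_gap : Tendsto r atTop atTop
  gap_small : ∀ k, ∀ᶠ m in atTop, k * r m ≤ m
  decoupled : ∀ T : ℕ, ∃ E : ℕ → ℝ, Tendsto E atTop (𝓝 0) ∧ ∀ᶠ m in atTop, ∀ p q : ℕ, ∀ u : ℝ,
    p + q ≤ T * m →
    |probLe P X (Finset.range p ∪ Finset.Ico (p + r m) (p + r m + q)) u -
      probLe P X (Finset.range p) u * probLe P X (Finset.range q) u| ≤ E m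

/-- Among `2 * k` consecutive blocks of length `r`, keep every other one. The discarded blocks serve
as gaps, and each decoupling costs `D`. -/
theorem probLe_range_le_pow {D : ℝ} {r m : ℕ} {u : ℝ} (hD : ∀ p q : ℕ, p + q ≤ m →
      |probLe P X (Finset.range p ∪ Finset.Ico (p + r) (p + r + q)) u -
        probLe P X (Finset.range p) u * probLe P X (Finset.range q) u| ≤ D)
    (k : ℕ) (hk : 2 * k * r ≤ m) :
    probLe P X (Finset.range (2 * k * r)) u ≤ probLe P X (Finset.range r) u ^ k + k * D := by
  induction k with
  | zero => simp [probLe_empty]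
  | succ k ih =>
    have e : 2 * (k + 1) * r = 2 * k * r + r + r := by ring
    rw [e] at hk ⊢
    have h1 := ih (by omega)
    have h2 := (abs_le.1 (hD (2 * k * r) r (by omega))).2
    have h3 : probLe P X (Finset.range (2 * k * r + r + r)) u ≤ probLe P X
        (Finset.range (2 * k * r) ∪ Finset.Ico (2 * k * r + r) (2 * k * r + r + r)) u := by
      refine probLe_anti (fun a ha => ?_) u
      simp only [Finset.mem_union, Finset.mem_range, Finset.mem_Ico] at ha ⊢
      omega
    have hD0 : 0 ≤ D := (abs_nonneg _).trans (hD 0 0 (by omega))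
    have z := probLe_nonneg (P := P) (X := X) (Finset.range r) u
    have o := probLe_le_one (P := P) (X := X) (Finset.range r) u
    have h4 := mul_le_mul_of_nonneg_right h1 z
    have h5 : (k * D) * probLe P X (Finset.range r) u ≤ k * D :=
      mul_le_of_le_one_right (by positivity) o
    rw [pow_succ]
    push_cast
    linarith

/-- The gap is cut out of the second block, leaving `q - r` indices. Filling it in the union and
restoring length `q` in the factor each cost at most one exceedance probability over `r` indices.
Truncated subtraction does no harm when `q < r`. -/
theorem StrictlyStationary.abs_probLe_range_add_sub_mul_le (hstat : StrictlyStationary P X)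
    (hX : ∀ j, Measurable (X j)) {D : ℝ} {p q r : ℕ} {u : ℝ}
    (hD : |probLe P X (Finset.range p ∪ Finset.Ico (p + r) (p + r + (q - r))) u -
        probLe P X (Finset.range p) u * probLe P X (Finset.range (q - r)) u| ≤ D) :
    |probLe P X (Finset.range (p + q)) u -
        probLe P X (Finset.range p) u * probLe P X (Finset.range q) u| ≤
      2 * (1 - probLe P X (Finset.range r) u) + D := by
  set J := Finset.range p ∪ Finset.Ico (p + r) (p + r + (q - r)) with hJ
  have hr : ∀ k, probLe P X (Finset.Ico k (k + r)) u = probLe P X (Finset.range r) u :=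
    fun k => hstat.probLe_Ico hX k r u
  have a1 : probLe P X J u ≤
      probLe P X (Finset.range (p + q)) u + (1 - probLe P X (Finset.range r) u) := by
    have h1 := probLe_le_union_add (P := P) hX J (Finset.Ico p (p + r)) u
    rw [hr] at h1
    refine h1.trans (add_le_add_left (probLe_anti (fun a ha => ?_) u) _)
    simp only [hJ, Finset.mem_union, Finset.mem_range, Finset.mem_Ico] at ha ⊢
    omega
  have a2 : probLe P X (Finset.range (p + q)) u ≤
      probLe P X J u + (1 - probLe P X (Finset.range r) u) := by
    have h1 := probLe_le_union_add (P := P) hX (Finset.range (p + q)) (Finset.Ico p (p + r)) u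
    rw [hr] at h1
    refine h1.trans (add_le_add_left (probLe_anti (fun a ha => ?_) u) _)
    simp only [hJ, Finset.mem_union, Finset.mem_range, Finset.mem_Ico] at ha ⊢
    omega
  have a3 : probLe P X (Finset.range (q - r)) u ≤
      probLe P X (Finset.range q) u + (1 - probLe P X (Finset.range r) u) := by
    have h1 := probLe_le_union_add (P := P) hX (Finset.range (q - r))
      (Finset.Ico (q - r) (q - r + r)) u
    rw [hr] at h1
    refine h1.trans (add_le_add_left (probLe_anti (fun a ha => ?_) u) _)
    simp only [Finset.mem_union, Finset.mem_range, Finset.mem_Ico] at ha ⊢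
    omega
  have a4 : probLe P X (Finset.range q) u ≤ probLe P X (Finset.range (q - r)) u :=
    probLe_anti (Finset.range_mono (Nat.sub_le q r)) u
  have z := probLe_nonneg (P := P) (X := X) (Finset.range p) u
  have o := probLe_le_one (P := P) (X := X) (Finset.range p) u
  have or := probLe_le_one (P := P) (X := X) (Finset.range r) u
  have a5 : probLe P X (Finset.range p) u * probLe P X (Finset.range q) u ≤
      probLe P X (Finset.range p) u * probLe P X (Finset.range (q - r)) u := by gcongr
  have a6 : probLe P X (Finset.range p) u *
      (probLe P X (Finset.range (q - r)) u - probLe P X (Finset.range q) u) ≤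
      1 - probLe P X (Finset.range r) u :=
    (mul_le_of_le_one_left (sub_nonneg.2 a4) o).trans (by linarith)
  have := abs_le.1 hD
  rw [abs_le]
  constructor <;> linarith [this.1, this.2]

/-- If a block of length `r m` kept probability at most `c' < 1`, then `k` decoupled copies with `c'
^ k < γ / 2` would push the value for length `m` below its limit `γ`. -/
theorem AsympDecoupled.tendsto_probLe_gap {r : ℕ → ℕ} (hdec : AsympDecoupled P X r) {v : ℕ → ℝ}
    {γ : ℝ} (hγ0 : 0 < γ)
    (hv : Tendsto (fun m => probLe P X (Finset.range m) (v m)) atTop (𝓝 γ)) :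
    Tendsto (fun m => probLe P X (Finset.range (r m)) (v m)) atTop (𝓝 1) := by
  refine tendsto_order.2 ⟨fun c hc => ?_, fun c hc =>
    Eventually.of_forall fun m => (probLe_le_one _ _).trans_lt hc⟩
  set c' := max c 0 with hc'
  have hc'1 : c' < 1 := max_lt hc one_pos
  obtain ⟨k, hk⟩ := exists_pow_lt_of_lt_one (half_pos hγ0) hc'1
  obtain ⟨E, hE0, hE⟩ := hdec.decoupled 1
  have hkE : Tendsto (fun m => (k : ℝ) * E m) atTop (𝓝 0) := by simpa using hE0.const_mul (k : ℝ)
  have hlim := (hv.sub hkE).eventually (lt_mem_nhds (by linarith : γ / 2 < γ - 0))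
  filter_upwards [hE, hlim, hdec.gap_small (2 * k)] with m hm hm2 hm3
  have h1 := probLe_range_le_pow (P := P) (X := X) (u := v m)
    (fun p q h => hm p q (v m) (by rwa [one_mul])) k hm3
  have h2 := probLe_anti (P := P) (X := X) (Finset.range_mono hm3) (v m)
  have h3 : c' ^ k < probLe P X (Finset.range (r m)) (v m) ^ k := by linarith
  exact (le_max_left _ _).trans_lt (lt_of_pow_lt_pow_left₀ k (probLe_nonneg _ _) h3)

theorem StrictlyStationary.admitsContinuousPhantom_of_asympDecoupled
    (hstat : StrictlyStationary P X) (hX : ∀ j, Measurable (X j))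
    (hcont : Continuous (cdf (P.map (X 0)))) {r : ℕ → ℕ} (hdec : AsympDecoupled P X r) :
    AdmitsContinuousPhantom P X := by
  -- Any limit in `(0, 1)` would do. Strict increase of the targets is what makes the levels
  -- strictly increasing.
  set γ : ℕ → ℝ := fun m => (1 / 2) * ((m : ℝ) / (m + 1)) with hγ
  have hγlim : Tendsto γ atTop (𝓝 (1 / 2)) := by
    have := (tendsto_natCast_div_add_atTop (1 : ℝ)).const_mul (1 / 2 : ℝ)
    rwa [mul_one] at this
  have hγmono : StrictMono γ := strictMono_nat_of_lt_succ fun m => by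
    simp only [hγ]
    refine mul_lt_mul_of_pos_left ?_ (by norm_num)
    rw [div_lt_div_iff₀ (by positivity) (by positivity)]
    push_cast
    nlinarith
  -- The index 0 is excluded: the empty block has probability 1 at every level, whereas `γ 0 = 0`.
  have hex : ∀ m : ℕ, ∃ u, 0 < m → probLe P X (Finset.range m) u = γ m := fun m => by
    rcases m.eq_zero_or_pos with rfl | hm
    · exact ⟨0, fun h => absurd h (lt_irrefl 0)⟩
    · have h1 : (0 : ℝ) < m := by exact_mod_cast hm
      obtain ⟨u, hu⟩ := hstat.exists_probLe_eq hX hcont hm (c := γ m)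
        (by simp only [hγ]; positivity) (by
          have := (div_lt_one (by positivity : (0 : ℝ) < m + 1)).2 (lt_add_one (m : ℝ))
          simp only [hγ]
          linarith)
      exact ⟨u, fun _ => hu⟩
  choose v hv using hex
  -- If the next level were not higher, the longer block at that level would have probability at
  -- most that of the shorter block at the old level, contradicting the increase of `γ`.
  have hvmono : StrictMono fun m => v (m + 1) := strictMono_nat_of_lt_succ fun m => by
    by_contra! h
    have h1 := probLe_mono (P := P) (X := X) (Finset.range (m + 1 + 1)) h
    have h2 := probLe_anti (P := P) (X := X) (Finset.range_mono (m + 1).le_succ) (v (m + 1))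
    rw [hv _ (by omega)] at h1 h2
    exact absurd (h1.trans h2) (not_le.2 (hγmono (m + 1).lt_succ_self))
  set a : ℕ → ℕ → ℝ := fun m n => probLe P X (Finset.range n) (v m) with ha
  have hdiag : Tendsto (fun m => a m m) atTop (𝓝 (1 / 2)) := by
    refine hγlim.congr' ?_
    filter_upwards [eventually_gt_atTop 0] with m hm
    exact (hv m hm).symm
  have hanti : ∀ m, Antitone (a m) := fun m n n' h => probLe_anti (Finset.range_mono h) _
  have hgap : Tendsto (fun m => a m (r m)) atTop (𝓝 1) :=
    hdec.tendsto_probLe_gap (by norm_num) hdiag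
  have hone : ∀ c, Tendsto (fun m => a m c) atTop (𝓝 1) := fun c => by
    refine tendsto_of_tendsto_of_tendsto_of_le_of_le' hgap tendsto_const_nhds ?_
      (Eventually.of_forall fun m => probLe_le_one _ _)
    filter_upwards [hdec.tendsto_gap.eventually_ge_atTop c] with m hm using hanti m hm
  have hmul : AsympMultiplicative a := fun T p q hpq => by
    obtain ⟨E, hE0, hE⟩ := hdec.decoupled T
    have h0 : Tendsto (fun m => 2 * (1 - a m (r m)) + E m) atTop (𝓝 0) := by
      simpa using ((hgap.const_sub 1).const_mul 2).add hE0
    refine squeeze_zero_norm' ?_ h0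
    filter_upwards [hE] with m hm
    exact hstat.abs_probLe_range_add_sub_mul_le hX
      (hm (p m) (q m - r m) (v m) ((Nat.add_le_add_left (Nat.sub_le _ _) _).trans (hpq m)))
  obtain ⟨G, hGc, hG, hGA⟩ := exists_continuous_df_pow_approx
    (A := fun n => probLe P X (Finset.range n)) (fun n u => probLe_nonneg _ _)
    (fun n u => probLe_le_one _ _) (fun n => probLe_mono _) hvmono
    (γ := 1 / 2) (by norm_num) (by norm_num) fun ε hε =>
      (tendsto_add_atTop_nat 1).eventually
        (hmul.eventually_abs_sub_rpow_le (fun _ _ => probLe_nonneg _ _)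
          (fun _ _ => probLe_le_one _ _) (fun m => probLe_empty _) hanti hone (by norm_num)
          (by norm_num) hdiag hε)
  refine ⟨G, hGc, hG, ?_⟩
  rw [Metric.tendsto_nhds]
  intro ε hε
  filter_upwards [hGA (ε / 2) (half_pos hε), eventually_gt_atTop 0] with n hn hn0
  have h1 : ⨆ u : ℝ, |P.real {ω | partialMax X n ω ≤ u} - G u ^ n| ≤ ε / 2 := by
    refine ciSup_le fun u => ?_
    rw [measureReal_partialMax_le hn0]
    exact hn u
  rw [dist_zero_right, Real.norm_of_nonneg (Real.iSup_nonneg fun u => abs_nonneg _)]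
  linarith

end Decoupling

/-! ### Choice of gap and smoothing scale -/

theorem tendsto_natCast_rpow_of_neg {x : ℝ} (hx : x < 0) :
    Tendsto (fun m : ℕ => (m : ℝ) ^ x) atTop (𝓝 0) := by
  have := (tendsto_rpow_neg_atTop (neg_pos.2 hx)).comp (tendsto_natCast_atTop_atTop (R := ℝ))
  simpa [Function.comp_def] using this

theorem tendsto_natCast_rpow_of_pos {x : ℝ} (hx : 0 < x) :
    Tendsto (fun m : ℕ => (m : ℝ) ^ x) atTop atTop :=
  (tendsto_rpow_atTop hx).comp tendsto_natCast_atTop_atTop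

theorem eventually_mul_ceil_rpow_le (k : ℕ) :
    ∀ᶠ m : ℕ in atTop, k * ⌈(m : ℝ) ^ (2 / 3 : ℝ)⌉₊ ≤ m := by
  filter_upwards [(tendsto_natCast_rpow_of_pos (by norm_num : (0 : ℝ) < 1 / 3)).eventually_ge_atTop
    (2 * k : ℝ), eventually_gt_atTop 0] with m hm hm0
  have hm1 : (1 : ℝ) ≤ m := by exact_mod_cast hm0
  have h1 : (1 : ℝ) ≤ (m : ℝ) ^ (2 / 3 : ℝ) := Real.one_le_rpow hm1 (by norm_num)
  have h2 := (Nat.ceil_lt_add_one (by positivity : (0 : ℝ) ≤ (m : ℝ) ^ (2 / 3 : ℝ))).le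
  have h3 : (m : ℝ) ^ (1 / 3 : ℝ) * (m : ℝ) ^ (2 / 3 : ℝ) = m := by
    rw [← Real.rpow_add (by positivity)]
    norm_num
  have h4 : (k : ℝ) * ⌈(m : ℝ) ^ (2 / 3 : ℝ)⌉₊ ≤ m := by
    calc (k : ℝ) * ⌈(m : ℝ) ^ (2 / 3 : ℝ)⌉₊ ≤ k * (2 * (m : ℝ) ^ (2 / 3 : ℝ)) := by
          gcongr
          linarith
      _ = 2 * k * (m : ℝ) ^ (2 / 3 : ℝ) := by ring
      _ ≤ (m : ℝ) ^ (1 / 3 : ℝ) * (m : ℝ) ^ (2 / 3 : ℝ) := by gcongr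
      _ = m := h3
  exact_mod_cast h4

variable {Ω : Type*} [MeasurableSpace Ω] {P : Measure Ω} [IsProbabilityMeasure P]
  {X : ℕ → Ω → ℝ}

/-- With gap at least `m ^ (2/3)`, the coefficient is `O(m ^ (-2β/3))`. The dominant covariance
error is of order `m ^ (2 + 3/b - 2β/3)`, and the hypothesis on `β` makes this exponent at most
`-1/b`. -/
theorem StrictlyStationary.asympDecoupled (hstat : StrictlyStationary P X)
    (hX : ∀ j, Measurable (X j)) {Ψ : Weight} (hΨ : ∀ s t f g, Ψ s t f g ≤ lambdaWeight s t f g)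
    {b : ℝ} (hb : 0 < b) (hconc : Concentration (cdf (P.map (X 0))) b) {β : ℝ}
    (hβ : 3 * (1 + 2 / b) ≤ β) (hrate : HasPolynomialRate (dependenceCoeff Ψ P X) β) :
    AsympDecoupled P X fun m => ⌈(m : ℝ) ^ (2 / 3 : ℝ)⌉₊ := by
  obtain ⟨B, hB, hF⟩ := hconc
  obtain ⟨C, hC⟩ := hrate
  have hgap : Tendsto (fun m : ℕ => ⌈(m : ℝ) ^ (2 / 3 : ℝ)⌉₊) atTop atTop :=
    tendsto_nat_ceil_atTop.comp (tendsto_natCast_rpow_of_pos (by norm_num))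
  have hb' : 0 < 1 / b := by positivity
  have hβ' : 3 + 6 * (1 / b) ≤ β := by
    have : 2 / b = 2 * (1 / b) := by ring
    linarith
  refine ⟨hgap, eventually_mul_ceil_rpow_le, fun T => ?_⟩
  refine ⟨fun m => T * B * (m : ℝ) ^ (-(1 / 2) : ℝ) +
    (|C| * T * (m : ℝ) ^ (1 + 3 / 2 * (1 / b) - 2 / 3 * β) +
      |C| * T ^ 2 * (m : ℝ) ^ (2 + 3 * (1 / b) - 2 / 3 * β)), ?_, ?_⟩
  · have h1 := (tendsto_natCast_rpow_of_neg
      (by norm_num : (-(1 / 2) : ℝ) < 0)).const_mul (T * B)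
    have h2 := (tendsto_natCast_rpow_of_neg
      (by linarith : 1 + 3 / 2 * (1 / b) - 2 / 3 * β < 0)).const_mul (|C| * T)
    have h3 := (tendsto_natCast_rpow_of_neg
      (by linarith : 2 + 3 * (1 / b) - 2 / 3 * β < 0)).const_mul (|C| * T ^ 2)
    simpa using h1.add (h2.add h3)
  filter_upwards [hgap.eventually hC, eventually_gt_atTop 0] with m hm hm0 p q u hpq
  have hmR : (0 : ℝ) < m := by exact_mod_cast hm0
  -- Chosen so that `m * δ ^ b = m ^ (-1/2)`, which makes the smoothing error vanish.
  set δ : ℝ := (m : ℝ) ^ (-(3 / 2 * (1 / b)))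
  have hδ : 0 < δ := by positivity
  have hδinv : δ⁻¹ = (m : ℝ) ^ (3 / 2 * (1 / b)) := by
    rw [← Real.rpow_neg hmR.le, neg_neg]
  have hδb : δ ^ b = (m : ℝ) ^ (-(3 / 2) : ℝ) := by
    rw [← Real.rpow_mul hmR.le]
    congr 1
    field_simp
  have hL : dependenceCoeff Ψ P X ⌈(m : ℝ) ^ (2 / 3 : ℝ)⌉₊ ≤
      ENNReal.ofReal (|C| * (m : ℝ) ^ (-(2 / 3 * β))) := by
    refine hm.trans (ENNReal.ofReal_le_ofReal ?_)
    have h1 : (⌈(m : ℝ) ^ (2 / 3 : ℝ)⌉₊ : ℝ) ^ (-β) ≤ ((m : ℝ) ^ (2 / 3 : ℝ)) ^ (-β) :=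
      Real.rpow_le_rpow_of_nonpos (by positivity) (Nat.le_ceil _) (by linarith)
    rw [← Real.rpow_mul hmR.le, mul_neg] at h1
    exact mul_le_mul (le_abs_self C) h1 (by positivity) (abs_nonneg C)
  refine (hstat.abs_probLe_union_sub_mul_le hX hΨ (by positivity) hL hδ p q u).trans ?_
  have hpqR : ((p + q : ℕ) : ℝ) ≤ T * m := by exact_mod_cast hpq
  have hpqmul : (p : ℝ) * q ≤ (T * m) ^ 2 := by
    have h1 : (p : ℝ) ≤ T * m := le_trans (by exact_mod_cast Nat.le_add_right p q) hpqR
    have h2 : (q : ℝ) ≤ T * m := le_trans (by exact_mod_cast Nat.le_add_left q p) hpqR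
    rw [sq]
    gcongr
  have hF0 : 0 ≤ cdf (P.map (X 0)) (u + δ) - cdf (P.map (X 0)) u :=
    sub_nonneg.2 (monotone_cdf _ (by linarith))
  have e1 : (m : ℝ) * δ ^ b = (m : ℝ) ^ (-(1 / 2) : ℝ) := by
    rw [hδb, mul_comm, ← Real.rpow_add_one hmR.ne']
    norm_num
  have e2 : (m : ℝ) ^ (-(2 / 3 * β)) * (m * δ⁻¹) =
      (m : ℝ) ^ (1 + 3 / 2 * (1 / b) - 2 / 3 * β) := by
    rw [hδinv, ← Real.rpow_one_add' hmR.le (by positivity), ← Real.rpow_add hmR]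
    ring_nf
  have e3 : (m : ℝ) ^ (-(2 / 3 * β)) * (m * δ⁻¹) ^ 2 =
      (m : ℝ) ^ (2 + 3 * (1 / b) - 2 / 3 * β) := by
    rw [hδinv, ← Real.rpow_one_add' hmR.le (by positivity), ← Real.rpow_natCast,
      ← Real.rpow_mul hmR.le, ← Real.rpow_add hmR]
    push_cast
    ring_nf
  calc (p + q : ℕ) * (cdf (P.map (X 0)) (u + δ) - cdf (P.map (X 0)) u) +
        |C| * (m : ℝ) ^ (-(2 / 3 * β)) * ((p + q : ℕ) * δ⁻¹ + p * q * δ⁻¹ ^ 2)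
      ≤ (T * m) * (B * δ ^ b) +
        |C| * (m : ℝ) ^ (-(2 / 3 * β)) * ((T * m) * δ⁻¹ + (T * m) ^ 2 * δ⁻¹ ^ 2) := by
        gcongr
        exact hF u δ hδ
    _ = T * B * (m * δ ^ b) + (|C| * T * ((m : ℝ) ^ (-(2 / 3 * β)) * (m * δ⁻¹)) +
        |C| * T ^ 2 * ((m : ℝ) ^ (-(2 / 3 * β)) * (m * δ⁻¹) ^ 2)) := by ring
    _ = _ := by rw [e1, e2, e3]

end PhantomDF

theorem mainTheorem9 {Ω : Type*} [MeasurableSpace Ω] (P : Measure Ω) [IsProbabilityMeasure P]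
    (X : ℕ → Ω → ℝ) (hX : ∀ j, Measurable (X j))
    (hstat : PhantomDF.StrictlyStationary P X)
    (hcont : Continuous (cdf (P.map (X 0))))
    (b : ℝ) (hb : 0 < b)
    (hconc : PhantomDF.Concentration (cdf (P.map (X 0))) b)
    (β : ℝ) (hβ : (1 + Real.sqrt 5) * (1 + 2 / b) < β) :
    (PhantomDF.WeaklyDependent PhantomDF.kappaWeight P X →
      PhantomDF.HasPolynomialRate
        (PhantomDF.dependenceCoeff PhantomDF.kappaWeight P X) β →
      PhantomDF.AdmitsContinuousPhantom P X) ∧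
    (PhantomDF.WeaklyDependent PhantomDF.lambdaWeight P X →
      PhantomDF.HasPolynomialRate
        (PhantomDF.dependenceCoeff PhantomDF.lambdaWeight P X) β →
      PhantomDF.AdmitsContinuousPhantom P X) := by

  have hβ3 : 3 * (1 + 2 / b) ≤ β := by
    have h5 : (2 : ℝ) ≤ Real.sqrt 5 := Real.le_sqrt_of_sq_le (by norm_num)
    have hb' : 0 < 1 + 2 / b := by positivity
    nlinarith
  exact ⟨fun _ h => hstat.admitsContinuousPhantom_of_asympDecoupled hX hcont
      (hstat.asympDecoupled hX (fun _ _ _ _ => le_add_self) hb hconc hβ3 h),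
    fun _ h => hstat.admitsContinuousPhantom_of_asympDecoupled hX hcont
      (hstat.asympDecoupled hX (fun _ _ _ _ => le_rfl) hb hconc hβ3 h)⟩
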